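/- For a $2\times 2$ complex matrix $T$, acting on $\mathbb{C}^2$ with its standard inner product, let $\|T\|$ be its operator norm, $W(T)=\{\langle Tx,x\rangle : x\in\mathbb{C}^2,\ \|x\|=1\}$ its numerical range, and $w(T)=\sup\{|\mu| : \mu\in W(T)\}$ its numerical radius. For $\alpha\in(0,\pi/2)$ let $S(\alpha)=\{a+ib : a,b\in\mathbb{R},\ |b|\le a\tan\alpha\}$, and let $S(\pi/2)=\{a+ib : a,b\in\mathbb{R},\ a\ge 0\}$ be the closed right half-plane. Let $\alpha\in(0,\pi/2]$ and let $T$ be a nonzero $2\times 2$ complex matrix with $W(T)\subseteq S(\alpha)$. Then $$\|T\|\le w(T)\sqrt{1+\sin^2\alpha}.$$ Equality holds if and only if $T/\|T\|$ is unitarily similar to the matrix $$\frac{1}{1+2s}\begin{pmatrix}\sqrt{1+s-s^2}+i\sqrt{s+s^2} & 2s\\ 0 & \sqrt{1+s-s^2}-i\sqrt{s+s^2}\end{pmatrix}\qquad\text{with } s=\sin^2\alpha,$$ that is, $U^*(T/\|T\|)U$ equals this matrix for some $2\times 2$ unitary matrix $U$. -/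

import Mathlib

/-- The numerical range `W(T) = {⟨T x, x⟩ : ‖x‖ = 1}` of a bounded operator. Mathlib's inner product
is conjugate-linear in its first argument, so `inner ℂ x (T x)` is the usual `⟨T x, x⟩`. -/
def numericalRange {H : Type*} [NormedAddCommGroup H] [InnerProductSpace ℂ H] (T : H →L[ℂ] H) :
    Set ℂ :=
  {μ | ∃ x : H, ‖x‖ = 1 ∧ inner ℂ x (T x) = μ}

/-- The numerical radius `w(T) = sup {|μ| : μ ∈ W(T)}`. -/
noncomputable def numericalRadius {H : Type*} [NormedAddCommGroup H] [InnerProductSpace ℂ H]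
    (T : H →L[ℂ] H) : ℝ :=
  sSup ((fun μ : ℂ => ‖μ‖) '' numericalRange T)

/-- The set whose supremum is the numerical radius is bounded above (by `‖T‖`). -/
theorem bddAbove_norm_numericalRange {H : Type*} [NormedAddCommGroup H] [InnerProductSpace ℂ H]
    (T : H →L[ℂ] H) : BddAbove ((fun μ : ℂ => ‖μ‖) '' numericalRange T) := by
  refine ⟨‖T‖, ?_⟩
  rintro _ ⟨_, ⟨x, hx, rfl⟩, rfl⟩
  calc ‖inner ℂ x (T x)‖ ≤ ‖x‖ * ‖T x‖ := norm_inner_le_norm x (T x)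
    _ ≤ ‖x‖ * (‖T‖ * ‖x‖) := by gcongr; exact T.le_opNorm x
    _ = ‖T‖ := by rw [hx]; ring

/-- The sector `S(α) = {a + i b : |b| ≤ a tan α}` for `0 ≤ α < π / 2`; for `α = π / 2`, where
`tan α` is infinite, it is the closed right half-plane. Multiplying by `cos α` covers both cases. -/
def sector (α : ℝ) : Set ℂ :=
  {z | |z.im| * Real.cos α ≤ z.re * Real.sin α}

theorem sector_eq_tan {α : ℝ} (h₀ : 0 ≤ α) (h₁ : α < Real.pi / 2) :
    sector α = {z : ℂ | |z.im| ≤ z.re * Real.tan α} := by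
  have hc : 0 < Real.cos α := Real.cos_pos_of_mem_Ioo ⟨by linarith [Real.pi_pos], h₁⟩
  ext z
  simp only [sector, Set.mem_ofPred_eq]
  rw [Real.tan_eq_sin_div_cos, ← mul_div_assoc, le_div_iff₀ hc]

theorem sector_pi_div_two : sector (Real.pi / 2) = {z : ℂ | 0 ≤ z.re} := by
  ext z
  simp [sector]

/-- The bounded operator on `ℂ²`, with its Euclidean (Hilbert space) norm, of a 2×2 matrix. -/
noncomputable def matOp (T : Matrix (Fin 2) (Fin 2) ℂ) :
    EuclideanSpace ℂ (Fin 2) →L[ℂ] EuclideanSpace ℂ (Fin 2) :=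
  Matrix.toEuclideanCLM (n := Fin 2) (𝕜 := ℂ) T

/-- `A` and `B` are unitarily similar: `B = U* A U` for some unitary matrix `U`. -/
def UnitarilySimilar (A B : Matrix (Fin 2) (Fin 2) ℂ) : Prop :=
  ∃ U ∈ Matrix.unitaryGroup (Fin 2) ℂ, B = star U * A * U

/-- The extremal upper-triangular matrix with parameter `s`. -/
noncomputable def extremalMatrix (s : ℝ) : Matrix (Fin 2) (Fin 2) ℂ :=
  (1 / (1 + 2 * (s : ℂ))) •
    !![(Real.sqrt (1 + s - s ^ 2) : ℂ) + Complex.I * (Real.sqrt (s + s ^ 2) : ℂ), 2 * (s : ℂ);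
       0, (Real.sqrt (1 + s - s ^ 2) : ℂ) - Complex.I * (Real.sqrt (s + s ^ 2) : ℂ)]

/-!
Normalize `‖T‖ = 1` and let `t`, `d` and `F` be the trace, the determinant and the squared
Frobenius norm of `T`. The singular values are `1` and `σ = |d|`, so `F = 1 + σ²`. For a `2 × 2`
matrix
  `det (m - Re (ζ T)) = m² - m Re (ζ t) + (|t|² - F) / 4 + Re (ζ² d) / 2`   when `|ζ| = 1`,
and this is nonnegative whenever `Re (ζ z) ≤ m` on the numerical range (`det_sub_re_nonneg`). Hence
all hypotheses become constraints on `t`, `d` and `σ`.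

* With `m = 0` and phases that carry the sector into a half-plane, one gets
  `|t|² ≥ (1 + σ)² - 4 σ sin² α`, with equality for `σ > 0` only if `d = σ` (`sector_det_bound`).
* With `m = w`, the constraint for all phases bounds `w` from below in terms of `|t|` and `σ`.
  Rotate so that `d` becomes `σ`. The least favourable rotated trace is real
  (`exists_unit_pair_ge`), and the most restrictive phase then has real part
  `min (1, w |t| / (2 σ))`. Eliminating `|t|` leaves a perfect square, `(2 σ s - (1 - σ))²` with
  `s = sin² α`, and gives `w² (1 + s) ≥ 1` (`radius_bound`).

Equality forces `σ = 1 / (1 + 2 s)`, `d = σ` and a real trace of prescribed size. These data agree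
with those of the extremal matrix, and trace, determinant and Frobenius norm determine a `2 × 2`
matrix up to unitary similarity (`unitarilySimilar_upper_triangular`). Conversely, the numerical
radius of the extremal matrix is bounded above directly on the Bloch sphere
(`norm_inner_extremalMatrix_le`), and the inequality already proved supplies the lower bound.
-/

/-! ### Scalar inequalities -/

/-- Among the pairs `(x, y)` of length `u`, the case `y = 0` is the least favourable. There, a unit
vector with first coordinate `k` has inner product `u k` with the pair. In general, some unit vector
`(κ, ν)` with `0 ≤ κ ≤ k` has an inner product at least as large. -/
theorem exists_unit_pair_ge {x y u k : ℝ} (hx : 0 ≤ x) (hy : 0 ≤ y) (hu : 0 ≤ u)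
    (huxy : u ^ 2 = x ^ 2 + y ^ 2) (hk0 : 0 ≤ k) (hk1 : k ≤ 1) :
    ∃ κ ν : ℝ, 0 ≤ κ ∧ κ ≤ k ∧ κ ^ 2 + ν ^ 2 = 1 ∧ u * k ≤ x * κ + y * ν ∧
      (k < 1 → y ≠ 0 → u * k < x * κ + y * ν) := by
  rcases le_or_gt (u * k) x with h | h
  · have hk : 0 ≤ 1 - k ^ 2 := by nlinarith
    obtain ⟨n, hn0, hn⟩ : ∃ n : ℝ, 0 ≤ n ∧ n ^ 2 = 1 - k ^ 2 :=
      ⟨√(1 - k ^ 2), Real.sqrt_nonneg _, Real.sq_sqrt hk⟩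
    -- `(u - x) k ≤ y n` because `y² = (u - x)(u + x)` and `u + x ≥ u (1 + k)`
    have hxu : x ≤ u := by nlinarith
    refine ⟨k, n, hk0, le_rfl, by linarith, ?_, ?_⟩
    · suffices (u - x) * k ≤ y * n by linarith
      refine abs_le_of_sq_le_sq' ?_ (mul_nonneg hy hn0) |>.2
      have h1 : y ^ 2 = (u - x) * (u + x) := by linarith
      have h2 : (y * n) ^ 2 - ((u - x) * k) ^ 2 = (u - x) * ((u + x) - 2 * u * k ^ 2) := by
        rw [mul_pow, hn, h1]; ring
      have h3 : 0 ≤ (u + x) - 2 * u * k ^ 2 := by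
        nlinarith [mul_nonneg (mul_nonneg hu hk0) (sub_nonneg.2 hk1),
          mul_nonneg hu (sub_nonneg.2 hk1)]
      nlinarith [mul_nonneg (sub_nonneg.2 hxu) h3]
    · intro hk1' hy0
      have hypos : 0 < y := lt_of_le_of_ne hy (Ne.symm hy0)
      have hxu' : x < u := by nlinarith
      suffices (u - x) * k < y * n by linarith
      refine abs_lt_of_sq_lt_sq' ?_ (mul_nonneg hy hn0) |>.2
      have h1 : y ^ 2 = (u - x) * (u + x) := by linarith
      have h2 : (y * n) ^ 2 - ((u - x) * k) ^ 2 = (u - x) * ((u + x) - 2 * u * k ^ 2) := by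
        rw [mul_pow, hn, h1]; ring
      have hu0 : 0 < u := by linarith
      have h3 : 0 < (u + x) - 2 * u * k ^ 2 := by
        nlinarith [mul_nonneg (mul_nonneg hu hk0) (sub_nonneg.2 hk1),
          mul_pos hu0 (sub_pos.2 hk1')]
      nlinarith [mul_pos (sub_pos.2 hxu') h3]
  · have hu0 : 0 < u := by
      rcases hu.eq_or_lt with h0 | h0
      · rw [← h0] at h; linarith
      · exact h0
    have hxu : x * (x / u) + y * (y / u) = u := by
      field_simp; linarith
    refine ⟨x / u, y / u, by positivity, ?_, ?_, ?_, ?_⟩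
    · rw [div_le_iff₀ hu0]; linarith
    · field_simp; linarith
    · rw [hxu]; nlinarith
    · intro h1 _
      rw [hxu]; nlinarith

/-- The case in which `σ κ² - w u κ` is minimal on `[0, 1]` at `κ = 1`; `hB` is the constraint there.
The bound is strict, so that there is no equality case. -/
theorem radius_bound_of_large {s σ w u : ℝ} (hs : 0 < s) (hσ : 0 ≤ σ) (hσ1 : σ ≤ 1)
    (hu : 0 ≤ u) (huw : u ≤ 2 * w) (hA : (1 + σ) ^ 2 - 4 * σ * s ≤ u ^ 2) (h : 2 * σ ≤ w * u)
    (hB : w * u ≤ w ^ 2 + (u ^ 2 - (1 + σ) ^ 2) / 4 + σ) : 1 < w ^ 2 * (1 + s) := by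
  have hm : u + (1 - σ) ≤ 2 * w := by
    have : (1 - σ) ^ 2 ≤ (2 * w - u) ^ 2 := by nlinarith
    have := abs_le_of_sq_le_sq' this (by linarith)
    linarith [this.2]
  have hw : 0 ≤ w := by linarith
  rcases le_or_gt 1 w with h1 | h1
  · nlinarith [one_le_pow₀ (n := 2) h1]
  have hs' : (1 - w) * (σ + w) ≤ σ * s := by nlinarith
  have hq : 2 * σ ≤ w * (2 * w - 1 + σ) := by nlinarith
  have hσ0 : 0 < σ := by
    rcases hσ.eq_or_lt with h0 | h0
    · subst h0; nlinarith
    · exact h0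
  have hw0 : 0 < w := by nlinarith
  -- since `σ (2 - w) ≤ w (2 w - 1)`, positivity of `w³ - σ (1 + w - w²)` reduces to
  -- `(1 - w)² (1 + w) > 0`
  have hc : σ * (1 + w) < w ^ 2 * (σ + w) := by
    have e1 : σ * (2 - w) * (1 + w - w ^ 2) ≤ w * (2 * w - 1) * (1 + w - w ^ 2) :=
      mul_le_mul_of_nonneg_right (by linarith) (by nlinarith)
    have e2 : 0 < w * ((1 - w) ^ 2 * (1 + w)) := by
      have : 0 < 1 - w := by linarith
      positivity
    have e3 : 0 < (2 - w) * (w ^ 2 * (σ + w) - σ * (1 + w)) := by nlinarith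
    have := pos_of_mul_pos_right e3 (by linarith)
    linarith
  have e4 : σ * 1 < σ * (w ^ 2 * (1 + s)) := by
    nlinarith [mul_le_mul_of_nonneg_left hs' (sq_nonneg w), mul_lt_mul_of_pos_right hc (sub_pos.2 h1)]
  exact lt_of_mul_lt_mul_left e4 hσ

/-- The case in which `σ κ² - w u κ` has its minimum inside `[0, 1)`, at `κ = w u / (2 σ)`. The slack
`δ` in the constraint `hB` must vanish when the bound is attained. -/
theorem radius_bound_of_small {s σ w u δ : ℝ} (hs : 0 < s) (hσ : 0 < σ)
    (hu : 0 ≤ u) (huw : u ≤ 2 * w) (hA : (1 + σ) ^ 2 - 4 * σ * s ≤ u ^ 2) (h : w * u < 2 * σ)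
    (hδ : 0 ≤ δ)
    (hB : w * u * (w * u / (2 * σ)) + δ ≤
      w ^ 2 + (u ^ 2 - (1 + σ) ^ 2) / 4 + σ * (w * u / (2 * σ)) ^ 2) :
    1 ≤ w ^ 2 * (1 + s) ∧
      (w ^ 2 * (1 + s) = 1 → σ * (1 + 2 * s) = 1 ∧ u ^ 2 = (1 + σ) ^ 2 - 4 * σ * s ∧ δ = 0) := by
  have hτ : 0 < 4 * σ - u ^ 2 := by nlinarith
  have hB' : σ * ((1 + σ) ^ 2 - u ^ 2) + 4 * σ * δ ≤ w ^ 2 * (4 * σ - u ^ 2) := by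
    have : σ * (w * u / (2 * σ)) ^ 2 = w * u * (w * u / (2 * σ)) / 2 := by
      field_simp
    have e : w * u * (w * u / (2 * σ)) * (2 * σ) = w ^ 2 * u ^ 2 := by
      field_simp
    rw [this] at hB
    nlinarith [mul_le_mul_of_nonneg_left hB (by linarith : 0 ≤ 4 * σ)]
  have hσδ : 0 ≤ σ * δ := by positivity
  have hwσ : σ ≤ w ^ 2 := by
    have : σ * (4 * σ - u ^ 2) ≤ w ^ 2 * (4 * σ - u ^ 2) := by
      nlinarith [mul_nonneg hσ.le (sq_nonneg (1 - σ))]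
    exact le_of_mul_le_mul_right this hτ
  -- `e` is the slack in `hA`
  set e := u ^ 2 - ((1 + σ) ^ 2 - 4 * σ * s) with he
  have he0 : 0 ≤ e := by linarith
  set G := 4 * σ * s - (1 - σ) ^ 2 with hG
  have h1 : 4 * σ ^ 2 * s + (w ^ 2 - σ) * e + 4 * σ * δ ≤ w ^ 2 * G := by
    have : u ^ 2 = e + ((1 + σ) ^ 2 - 4 * σ * s) := by rw [he]; ring
    rw [this] at hB'
    nlinarith
  have hwe : 0 ≤ (w ^ 2 - σ) * e := mul_nonneg (by linarith) he0
  have hsσ : 0 < σ ^ 2 * s := by positivity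
  have hGpos : 0 < G := by
    have : 0 < w ^ 2 * G := by nlinarith
    exact pos_of_mul_pos_right this (sq_nonneg w)
  have h2 : 4 * σ ^ 2 * s * (1 + s) = G + (2 * σ * s - (1 - σ)) ^ 2 := by rw [hG]; ring
  have h3 : G + ((2 * σ * s - (1 - σ)) ^ 2 + ((w ^ 2 - σ) * e + 4 * σ * δ) * (1 + s)) ≤
      w ^ 2 * (1 + s) * G := by
    nlinarith [mul_le_mul_of_nonneg_right h1 (by linarith : 0 ≤ 1 + s)]
  have h4 : 0 ≤ ((w ^ 2 - σ) * e + 4 * σ * δ) * (1 + s) :=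
    mul_nonneg (by linarith) (by linarith)
  refine ⟨?_, fun hw => ?_⟩
  · have : 1 * G ≤ w ^ 2 * (1 + s) * G := by nlinarith [sq_nonneg (2 * σ * s - (1 - σ))]
    exact le_of_mul_le_mul_right this hGpos
  · rw [hw, one_mul] at h3
    have h5 : 2 * σ * s - (1 - σ) = 0 := by
      have : (2 * σ * s - (1 - σ)) ^ 2 = 0 :=
        le_antisymm (by linarith) (sq_nonneg _)
      exact pow_eq_zero_iff (two_ne_zero) |>.1 this
    have h6 : (w ^ 2 - σ) * e + 4 * σ * δ ≤ 0 := by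
      have : ((w ^ 2 - σ) * e + 4 * σ * δ) * (1 + s) ≤ 0 := by
        linarith [sq_nonneg (2 * σ * s - (1 - σ))]
      nlinarith
    have h7 : σ * δ = 0 := by linarith
    have h8 : (w ^ 2 - σ) * e = 0 := by linarith
    have h9 : σ < w ^ 2 := by
      by_contra! hle
      have : w ^ 2 = σ := le_antisymm hle hwσ
      rw [this] at hw
      have : σ * s = 0 := by linarith
      have : 0 < σ * s := by positivity
      linarith
    refine ⟨by linarith, ?_, ?_⟩
    · rcases mul_eq_zero.1 h8 with h | h <;> linarith
    · rcases mul_eq_zero.1 h7 with h | h <;> linarith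

/-- The scalar form of the theorem. For a matrix of norm one, `σ` is the modulus of the determinant,
`u` that of the trace, and `x + i y` the trace after the rotation that makes the determinant equal
to `σ`. The hypothesis `hB` says that `w - Re (ζ T)` has nonnegative determinant for every phase
`ζ`, and `hA` is what the sector condition gives. -/
theorem radius_bound {s σ w x y u : ℝ} (hs : 0 < s) (hσ : 0 ≤ σ) (hσ1 : σ ≤ 1)
    (hu : 0 ≤ u) (huxy : u ^ 2 = x ^ 2 + y ^ 2) (huw : u ≤ 2 * w)
    (hA : (1 + σ) ^ 2 - 4 * σ * s ≤ u ^ 2)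
    (hB : ∀ κ ν : ℝ, κ ^ 2 + ν ^ 2 = 1 →
      0 ≤ w ^ 2 - w * (κ * x - ν * y) + (u ^ 2 - (1 + σ ^ 2)) / 4 + σ * (κ ^ 2 - ν ^ 2) / 2) :
    1 ≤ w ^ 2 * (1 + s) ∧
      (w ^ 2 * (1 + s) = 1 →
        σ * (1 + 2 * s) = 1 ∧ u ^ 2 = (1 + σ) ^ 2 - 4 * σ * s ∧ y = 0) := by
  have hw : 0 ≤ w := by linarith
  have hB' : ∀ κ ν : ℝ, κ ^ 2 + ν ^ 2 = 1 →
      w * (|x| * κ + |y| * ν) ≤ w ^ 2 + (u ^ 2 - (1 + σ) ^ 2) / 4 + σ * κ ^ 2 := by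
    intro κ ν h
    have key : ∀ κ' ν' : ℝ, κ' ^ 2 = κ ^ 2 → ν' ^ 2 = ν ^ 2 →
        w * (κ' * x - ν' * y) ≤ w ^ 2 + (u ^ 2 - (1 + σ) ^ 2) / 4 + σ * κ ^ 2 := by
      intro κ' ν' h1 h2
      have h3 := hB κ' ν' (by linarith)
      have h4 : ν' ^ 2 = 1 - κ ^ 2 := by linarith
      rw [h4, h1] at h3
      linarith
    rcases abs_choice x with hx | hx <;> rcases abs_choice y with hy | hy <;> rw [hx, hy]
    · convert key κ (-ν) rfl (by ring) using 2; ring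
    · convert key κ ν rfl rfl using 2; ring
    · convert key (-κ) (-ν) (by ring) (by ring) using 2; ring
    · convert key (-κ) ν (by ring) rfl using 2; ring
  have huxy' : u ^ 2 = |x| ^ 2 + |y| ^ 2 := by simpa using huxy
  rcases le_or_gt (2 * σ) (w * u) with h | h
  · obtain ⟨κ, ν, h0, h1, h2, h3, -⟩ :=
      exists_unit_pair_ge (abs_nonneg x) (abs_nonneg y) hu huxy' zero_le_one le_rfl
    have h4 : 1 < w ^ 2 * (1 + s) := by
      refine radius_bound_of_large hs hσ hσ1 hu huw hA h ?_
      have := hB' κ ν h2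
      nlinarith [mul_le_mul_of_nonneg_left h3 hw, mul_nonneg hσ (by nlinarith : 0 ≤ 1 - κ ^ 2)]
    exact ⟨h4.le, fun h5 => absurd h5 h4.ne'⟩
  · have hσ0 : 0 < σ := by nlinarith [mul_nonneg hw hu]
    have hk0 : 0 ≤ w * u / (2 * σ) := by positivity
    have hk1 : w * u / (2 * σ) < 1 := by rw [div_lt_one (by positivity)]; exact h
    obtain ⟨κ, ν, h0, h1, h2, h3, h4⟩ :=
      exists_unit_pair_ge (abs_nonneg x) (abs_nonneg y) hu huxy' hk0 hk1.le
    have hδ : 0 ≤ w * (|x| * κ + |y| * ν - u * (w * u / (2 * σ))) :=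
      mul_nonneg hw (by linarith)
    have := radius_bound_of_small hs hσ0 hu huw hA h hδ (by
      have := hB' κ ν h2
      have h5 : σ * κ ^ 2 ≤ σ * (w * u / (2 * σ)) ^ 2 := by gcongr
      linarith)
    refine ⟨this.1, fun h6 => ?_⟩
    obtain ⟨h7, h8, h9⟩ := this.2 h6
    refine ⟨h7, h8, ?_⟩
    by_contra hy
    have h10 := h4 hk1 (abs_ne_zero.2 hy)
    rcases mul_eq_zero.1 h9 with h11 | h11
    · rw [h11] at h6; norm_num at h6
    · linarith

/-- Here `c + i r` stands for `exp (i α)`, and `p + i q` is the phase whose square rotates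
a determinant of modulus `σ` to the positive axis. The hypothesis `hK` is the nonnegativity of
`det Re (ζ T)` for the phases `ζ = a + i b` that map the sector into the right half-plane. -/
theorem sector_det_bound {c r p q σ K : ℝ} (hc : 0 ≤ c) (hr : 0 < r) (hcr : c ^ 2 + r ^ 2 = 1)
    (hp : 0 ≤ p) (hpq : p ^ 2 + q ^ 2 = 1) (hσ : 0 ≤ σ)
    (hK : ∀ a b : ℝ, 0 ≤ a → a ^ 2 + b ^ 2 = 1 → |b| * r ≤ a * c →
      0 ≤ K + σ * ((a ^ 2 - b ^ 2) * (p ^ 2 - q ^ 2) + 4 * a * b * p * q) / 2) :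
    σ * (1 - 2 * r ^ 2) / 2 ≤ K ∧ (K = σ * (1 - 2 * r ^ 2) / 2 → 0 < σ → q = 0) := by
  have hr2 : 0 < r ^ 2 := by positivity
  rcases le_or_gt (p * r) (|q| * c) with h | h
  -- `± i (p + i q)` is an admissible phase, and rotates the determinant to `-σ`
  · have h1 : σ / 2 ≤ K := by
      have key : ∀ b : ℝ, |b| = p → b * q = - (p * |q|) → σ / 2 ≤ K := by
        intro b hb hbq
        have hb2 : b ^ 2 = p ^ 2 := by rw [← hb, sq_abs]
        have := hK |q| b (abs_nonneg q) (by rw [hb2, sq_abs]; linarith) (by rw [hb]; exact h)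
        have e : (|q| ^ 2 - b ^ 2) * (p ^ 2 - q ^ 2) + 4 * |q| * b * p * q = -1 := by
          have e1 : 4 * |q| * b * p * q = - (4 * p ^ 2 * q ^ 2) := by
            rw [show 4 * |q| * b * p * q = 4 * |q| * p * (b * q) by ring, hbq, ← sq_abs q]; ring
          rw [e1, hb2, sq_abs]
          linear_combination (-(p ^ 2 + q ^ 2) - 1) * hpq
        rw [e] at this
        linarith
      rcases abs_choice q with hq | hq
      · exact key (-p) (by rw [abs_neg, abs_of_nonneg hp]) (by rw [hq]; ring)
      · exact key p (abs_of_nonneg hp) (by rw [hq]; ring)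
    refine ⟨by nlinarith, fun h2 h3 => ?_⟩
    nlinarith [mul_pos h3 hr2]
  -- otherwise the extreme phase `r ± i c` gives the bound
  · have h1 : 0 ≤ K - σ * ((1 - 2 * r ^ 2) * (p ^ 2 - q ^ 2) + 4 * r * c * (p * |q|)) / 2 := by
      have key : ∀ b : ℝ, |b| = c → b * q = - (c * |q|) → _ := fun b hb hbq => by
        have hb2 : b ^ 2 = c ^ 2 := by rw [← hb, sq_abs]
        have := hK r b hr.le (by rw [hb2]; linarith) (by rw [hb]; linarith)
        rw [show 4 * r * b * p * q = 4 * r * p * (b * q) by ring, hbq, hb2] at this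
        have e : c ^ 2 = 1 - r ^ 2 := by linarith
        rw [e] at this
        have : 0 ≤ K - σ * ((1 - 2 * r ^ 2) * (p ^ 2 - q ^ 2) + 4 * r * c * (p * |q|)) / 2 := by
          linarith
        exact this
      rcases abs_choice q with hq | hq
      · exact key (-c) (by rw [abs_neg, abs_of_nonneg hc]) (by rw [hq]; ring)
      · exact key c (abs_of_nonneg hc) (by rw [hq]; ring)
    have e : (1 - 2 * r ^ 2) * (p ^ 2 - q ^ 2) + 4 * r * c * (p * |q|) =
        1 - 2 * r ^ 2 + 2 * |q| * (2 * c * (p * r - |q| * c) + |q|) := by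
      have e1 : p ^ 2 = 1 - |q| ^ 2 := by rw [sq_abs]; linarith
      have e2 : r ^ 2 = 1 - c ^ 2 := by linarith
      rw [e1, e2, ← sq_abs q]; ring
    rw [e] at h1
    have h2 : 0 ≤ 2 * c * (p * r - |q| * c) := mul_nonneg (by linarith) (by linarith)
    have h3 : 0 ≤ |q| := abs_nonneg q
    have h4 : |q| ^ 2 ≤ 2 * |q| * (2 * c * (p * r - |q| * c) + |q|) := by nlinarith [mul_nonneg h3 h2]
    have h5 : 0 ≤ σ * |q| ^ 2 := by positivity
    have h6 := mul_le_mul_of_nonneg_left h4 hσ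
    refine ⟨by linarith, fun h7 h8 => ?_⟩
    have h9 : σ * |q| ^ 2 = 0 := by linarith
    rcases mul_eq_zero.1 h9 with h | h
    · linarith
    · simpa using h

/-! ### Quadratic forms of 2×2 matrices -/

/-- The squared Frobenius norm `tr (M* M)`, the sum of the squared moduli of the entries. -/
noncomputable def frobeniusSq (M : Matrix (Fin 2) (Fin 2) ℂ) : ℝ :=
  (M.conjTranspose * M).trace.re

theorem frobeniusSq_eq_sum (M : Matrix (Fin 2) (Fin 2) ℂ) :
    frobeniusSq M = ‖M 0 0‖ ^ 2 + ‖M 0 1‖ ^ 2 + ‖M 1 0‖ ^ 2 + ‖M 1 1‖ ^ 2 := by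
  simp only [frobeniusSq, Matrix.trace_fin_two, Matrix.mul_apply, Fin.sum_univ_two,
    Matrix.conjTranspose_apply, Complex.sq_norm, Complex.normSq_apply]
  simp
  ring

theorem inner_matOp (M : Matrix (Fin 2) (Fin 2) ℂ) (x : EuclideanSpace ℂ (Fin 2)) :
    inner ℂ x (matOp M x) = star (x 0) * (M 0 0 * x 0 + M 0 1 * x 1) +
      star (x 1) * (M 1 0 * x 0 + M 1 1 * x 1) := by
  rw [EuclideanSpace.inner_eq_star_dotProduct, matOp, Matrix.ofLp_toEuclideanCLM]
  simp [Matrix.mulVec, dotProduct, Fin.sum_univ_two]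
  ring

theorem matOp_smul (c : ℂ) (M : Matrix (Fin 2) (Fin 2) ℂ) : matOp (c • M) = c • matOp M :=
  map_smul _ _ _

theorem norm_sq_fin_two (x : EuclideanSpace ℂ (Fin 2)) : ‖x‖ ^ 2 = ‖x 0‖ ^ 2 + ‖x 1‖ ^ 2 := by
  rw [EuclideanSpace.norm_sq_eq, Fin.sum_univ_two]

open scoped ComplexOrder in
/-- The right-hand side is the determinant of the positive semidefinite matrix `m - Re M`. -/
theorem det_sub_re_nonneg (M : Matrix (Fin 2) (Fin 2) ℂ) (m : ℝ)
    (h : ∀ x : EuclideanSpace ℂ (Fin 2), (inner ℂ x (matOp M x)).re ≤ m * ‖x‖ ^ 2) :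
    0 ≤ m ^ 2 - m * M.trace.re + (‖M.trace‖ ^ 2 - frobeniusSq M) / 4 + M.det.re / 2 := by
  have hA : Matrix.PosSemidef ((2 * m : ℂ) • (1 : Matrix (Fin 2) (Fin 2) ℂ) -
      (M + M.conjTranspose)) := by
    refine .of_dotProduct_mulVec_nonneg ?_ fun x => ?_
    · ext i j
      fin_cases i <;> fin_cases j <;> simp [add_comm]
    · have hx := h (WithLp.toLp 2 x)
      have e : star x ⬝ᵥ (((2 * m : ℂ) • (1 : Matrix (Fin 2) (Fin 2) ℂ) -
          (M + M.conjTranspose)).mulVec x) = ((2 * (m * ‖WithLp.toLp 2 x‖ ^ 2 -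
            (inner ℂ (WithLp.toLp 2 x) (matOp M (WithLp.toLp 2 x))).re) : ℝ) : ℂ) := by
        rw [inner_matOp, norm_sq_fin_two]
        simp only [Complex.sq_norm, Complex.normSq_apply]
        apply Complex.ext <;>
        simp [Matrix.mulVec, dotProduct, Fin.sum_univ_two] <;> ring
      rw [e]
      exact_mod_cast (by linarith)
  have h2 := (Complex.le_def.1 hA.det_nonneg).1
  rw [Matrix.det_fin_two] at h2
  rw [frobeniusSq_eq_sum, Matrix.det_fin_two, Matrix.trace_fin_two]
  simp only [Complex.sq_norm, Complex.normSq_apply]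
  simp at h2 ⊢
  linarith

theorem norm_matOp_sq (M : Matrix (Fin 2) (Fin 2) ℂ) (x : EuclideanSpace ℂ (Fin 2)) :
    ‖matOp M x‖ ^ 2 = ‖M 0 0 * x 0 + M 0 1 * x 1‖ ^ 2 + ‖M 1 0 * x 0 + M 1 1 * x 1‖ ^ 2 := by
  rw [norm_sq_fin_two]
  simp [matOp, Matrix.ofLp_toEuclideanCLM, Matrix.mulVec, dotProduct, Fin.sum_univ_two]

/-- The operator norm is attained, by compactness of the unit sphere. -/
theorem exists_norm_matOp_eq (M : Matrix (Fin 2) (Fin 2) ℂ) :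
    ∃ x : EuclideanSpace ℂ (Fin 2), ‖x‖ = 1 ∧ ‖matOp M x‖ = ‖matOp M‖ := by
  obtain ⟨x, hx, hmax⟩ := (isCompact_sphere (0 : EuclideanSpace ℂ (Fin 2)) 1).exists_isMaxOn
    (NormedSpace.sphere_nonempty.2 zero_le_one) (matOp M).continuous.norm.continuousOn
  have hx1 : ‖x‖ = 1 := by simpa using hx
  refine ⟨x, hx1, le_antisymm ?_ ?_⟩
  · simpa [hx1] using (matOp M).le_opNorm x
  · refine ContinuousLinearMap.opNorm_le_of_unit_norm (norm_nonneg _) fun y hy => ?_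
    exact hmax (by simpa using hy)

open scoped ComplexOrder in
/-- The singular values of a matrix of norm one are `1` and `|det M|`. -/
theorem frobeniusSq_of_norm_eq_one (M : Matrix (Fin 2) (Fin 2) ℂ) (h : ‖matOp M‖ = 1) :
    frobeniusSq M = 1 + ‖M.det‖ ^ 2 ∧ ‖M.det‖ ≤ 1 := by
  have hle (x : EuclideanSpace ℂ (Fin 2)) : ‖matOp M x‖ ^ 2 ≤ ‖x‖ ^ 2 := by
    have := (matOp M).le_opNorm x
    rw [h, one_mul] at this
    gcongr
  have hform (x : EuclideanSpace ℂ (Fin 2)) : star x.ofLp ⬝ᵥ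
      ((1 - M.conjTranspose * M).mulVec x.ofLp) = ((‖x‖ ^ 2 - ‖matOp M x‖ ^ 2 : ℝ) : ℂ) := by
    rw [norm_matOp_sq, norm_sq_fin_two]
    simp only [Complex.sq_norm, Complex.normSq_apply]
    apply Complex.ext <;>
    simp [Matrix.mulVec, dotProduct, Fin.sum_univ_two, Matrix.mul_apply] <;> ring
  have hA : Matrix.PosSemidef (1 - M.conjTranspose * M) := by
    refine .of_dotProduct_mulVec_nonneg ?_ fun x => ?_
    · exact Matrix.isHermitian_one.sub (Matrix.isHermitian_conjTranspose_mul_self M)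
    · have := hle (WithLp.toLp 2 x)
      rw [hform (WithLp.toLp 2 x)]
      exact_mod_cast sub_nonneg.2 this
  obtain ⟨x, hx, hMx⟩ := exists_norm_matOp_eq M
  have hker : (1 - M.conjTranspose * M).mulVec x.ofLp = 0 := by
    rw [← hA.dotProduct_mulVec_zero_iff, hform, hMx, hx, h]
    simp
  have hdet : (1 - M.conjTranspose * M).det = 0 := by
    refine Matrix.exists_mulVec_eq_zero_iff.1 ⟨x.ofLp, fun h0 => ?_, hker⟩
    have : x = 0 := by ext i; simp [h0]
    simp [this] at hx
  have hF : frobeniusSq M = 1 + ‖M.det‖ ^ 2 := by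
    have := congrArg Complex.re hdet
    rw [Matrix.det_fin_two] at this
    rw [frobeniusSq_eq_sum, Matrix.det_fin_two]
    simp only [Complex.sq_norm, Complex.normSq_apply]
    simp [Matrix.mul_apply, Fin.sum_univ_two] at this ⊢
    linarith
  refine ⟨hF, ?_⟩
  have h0 := hle (EuclideanSpace.single 0 1)
  have h1 := hle (EuclideanSpace.single 1 1)
  rw [norm_matOp_sq] at h0 h1
  rw [frobeniusSq_eq_sum] at hF
  simp at h0 h1
  nlinarith [norm_nonneg M.det]

/-! ### Unitary invariants -/

theorem UnitarilySimilar.trace_eq {A B : Matrix (Fin 2) (Fin 2) ℂ} (h : UnitarilySimilar A B) :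
    B.trace = A.trace := by
  obtain ⟨U, hU, rfl⟩ := h
  rw [Matrix.mul_assoc, Matrix.trace_mul_comm, Matrix.mul_assoc, Matrix.mem_unitaryGroup_iff.1 hU,
    mul_one]

theorem UnitarilySimilar.frobeniusSq_eq {A B : Matrix (Fin 2) (Fin 2) ℂ}
    (h : UnitarilySimilar A B) : frobeniusSq B = frobeniusSq A := by
  have hs : UnitarilySimilar (A.conjTranspose * A) (B.conjTranspose * B) := by
    obtain ⟨U, hU, rfl⟩ := h
    refine ⟨U, hU, ?_⟩
    have h1 : U * star U = 1 := Matrix.mem_unitaryGroup_iff.1 hU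
    simp only [← Matrix.star_eq_conjTranspose, star_mul, star_star]
    calc star U * (star A * U) * (star U * A * U) = star U * star A * (U * star U) * A * U := by
          simp only [mul_assoc]
      _ = _ := by rw [h1]; simp only [mul_assoc, mul_one]
  rw [frobeniusSq, frobeniusSq, hs.trace_eq]

theorem UnitarilySimilar.exists_inner_eq {A B : Matrix (Fin 2) (Fin 2) ℂ}
    (h : UnitarilySimilar A B) (x : EuclideanSpace ℂ (Fin 2)) (hx : ‖x‖ = 1) :
    ∃ y : EuclideanSpace ℂ (Fin 2), ‖y‖ = 1 ∧ inner ℂ y (matOp B y) = inner ℂ x (matOp A x) := by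
  obtain ⟨U, hU, rfl⟩ := h
  have h1 : U * star U = 1 := Matrix.mem_unitaryGroup_iff.1 hU
  have hmul : ∀ (P Q : Matrix (Fin 2) (Fin 2) ℂ) z, matOp (P * Q) z = matOp P (matOp Q z) :=
    fun P Q z => by simp [matOp, map_mul]
  have hone : ∀ z, matOp 1 z = z := fun z => by simp [matOp]
  have hadj : ∀ y z : EuclideanSpace ℂ (Fin 2),
      inner ℂ y (matOp (star U) z) = inner ℂ (matOp U y) z := fun y z => by
    rw [matOp, map_star, ContinuousLinearMap.star_eq_adjoint,
      ContinuousLinearMap.adjoint_inner_right, matOp]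
  have hUx : matOp U (matOp (star U) x) = x := by rw [← hmul, h1, hone]
  refine ⟨matOp (star U) x, ?_, ?_⟩
  · have : inner ℂ (matOp (star U) x) (matOp (star U) x) = inner ℂ x x := by
      rw [hadj, hUx]
    have h2 := congrArg RCLike.re this
    rw [inner_self_eq_norm_sq, inner_self_eq_norm_sq, hx, one_pow] at h2
    exact (pow_eq_one_iff_of_nonneg (norm_nonneg _) two_ne_zero).1 h2
  · rw [hmul, hmul, hUx, hadj, hUx]

theorem exists_phase_mul_eq {b : ℂ} {r : ℝ} (h : ‖b‖ = r) : ∃ μ : ℂ, ‖μ‖ = 1 ∧ μ * b = r := by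
  rcases eq_or_ne b 0 with rfl | hb
  · exact ⟨1, by simp, by simp [← h]⟩
  · have hb' : (‖b‖ : ℂ) ≠ 0 := by simpa using hb
    refine ⟨‖b‖ / b, ?_, ?_⟩
    · simp [hb]
    · rw [div_mul_cancel₀ _ hb, h]

/-- Trace, determinant and Frobenius norm form a complete set of unitary invariants of a
`2 × 2` matrix; here for an upper triangular target with nonnegative off-diagonal entry. -/
theorem unitarilySimilar_upper_triangular (A : Matrix (Fin 2) (Fin 2) ℂ) (l₁ l₂ : ℂ) (r : ℝ)
    (hr : 0 ≤ r) (ht : A.trace = l₁ + l₂) (hd : A.det = l₁ * l₂)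
    (hF : frobeniusSq A = ‖l₁‖ ^ 2 + ‖l₂‖ ^ 2 + r ^ 2) :
    UnitarilySimilar A !![l₁, (r : ℂ); 0, l₂] := by
  have hdet : (A - l₁ • (1 : Matrix (Fin 2) (Fin 2) ℂ)).det = 0 := by
    rw [Matrix.det_fin_two] at hd ⊢
    rw [Matrix.trace_fin_two] at ht
    simp
    linear_combination hd - l₁ * ht
  obtain ⟨v, hv0, hv⟩ := Matrix.exists_mulVec_eq_zero_iff.2 hdet
  have hn0 : ‖WithLp.toLp 2 v‖ ≠ 0 := by simpa using hv0
  set n := ‖WithLp.toLp 2 v‖ with hn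
  have hn2 : n ^ 2 = ‖v 0‖ ^ 2 + ‖v 1‖ ^ 2 := norm_sq_fin_two _
  obtain ⟨p, q, hpq, h0, h1⟩ : ∃ p q : ℂ, star p * p + star q * q = 1 ∧
      A 0 0 * p + A 0 1 * q = l₁ * p ∧ A 1 0 * p + A 1 1 * q = l₁ * q := by
    have h0 := congrFun hv 0
    have h1 := congrFun hv 1
    simp [Matrix.mulVec, dotProduct, Fin.sum_univ_two] at h0 h1
    refine ⟨v 0 / n, v 1 / n, ?_, by linear_combination h0 / n, by linear_combination h1 / n⟩
    have hnC : (n : ℂ) ≠ 0 := by exact_mod_cast hn0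
    have hn2' : (n : ℂ) ^ 2 = star (v 0) * v 0 + star (v 1) * v 1 := by
      have : ∀ z : ℂ, star z * z = ((‖z‖ ^ 2 : ℝ) : ℂ) := fun z => by
        rw [Complex.star_def, Complex.conj_mul']; push_cast; rfl
      rw [this, this]
      exact_mod_cast hn2
    simp only [star_div₀, Complex.star_def, Complex.conj_ofReal] at hn2' ⊢
    field_simp
    rw [hn2']
  -- conjugation by `V μ` is triangular for every phase `μ`, which multiplies the corner entry
  let V : ℂ → Matrix (Fin 2) (Fin 2) ℂ := fun μ => !![p, -(μ * star q); q, μ * star p]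
  have hV : ∀ μ : ℂ, ‖μ‖ = 1 → V μ ∈ Matrix.unitaryGroup (Fin 2) ℂ := by
    intro μ hμ
    have hμ' : star μ * μ = 1 := by
      rw [Complex.star_def, Complex.conj_mul', hμ]; simp
    rw [Matrix.mem_unitaryGroup_iff']
    simp only [Complex.star_def] at hμ' hpq
    ext i j
    fin_cases i <;> fin_cases j <;>
      simp [V, Matrix.mul_apply, Fin.sum_univ_two, Matrix.star_apply]
    · exact hpq
    · ring
    · ring
    · linear_combination hpq * (starRingEnd ℂ μ * μ) + hμ'
  have hcol : ∀ μ : ℂ, ‖μ‖ = 1 → (star (V μ) * A * V μ) 0 0 = l₁ ∧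
      (star (V μ) * A * V μ) 1 0 = 0 := by
    intro μ _
    simp only [Complex.star_def] at hpq
    constructor
    · simp [V, Matrix.mul_apply, Fin.sum_univ_two, Matrix.star_apply]
      linear_combination starRingEnd ℂ p * h0 + starRingEnd ℂ q * h1 + l₁ * hpq
    · simp [V, Matrix.mul_apply, Fin.sum_univ_two, Matrix.star_apply]
      linear_combination starRingEnd ℂ μ * (p * h1 - q * h0)
  have hlast : ∀ μ : ℂ, ‖μ‖ = 1 → (star (V μ) * A * V μ) 1 1 = l₂ := by
    intro μ hμ
    have hs : UnitarilySimilar A (star (V μ) * A * V μ) := ⟨V μ, hV μ hμ, rfl⟩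
    have := hs.trace_eq
    rw [Matrix.trace_fin_two, (hcol μ hμ).1, ht] at this
    linear_combination this
  have hcorner : ‖(star (V 1) * A * V 1) 0 1‖ = r := by
    have hs : UnitarilySimilar A (star (V 1) * A * V 1) := ⟨V 1, hV 1 (by simp), rfl⟩
    have := hs.frobeniusSq_eq
    rw [hF, frobeniusSq_eq_sum, (hcol 1 (by simp)).1, (hcol 1 (by simp)).2,
      hlast 1 (by simp)] at this
    refine (pow_left_inj₀ (norm_nonneg _) hr two_ne_zero).1 ?_
    simp at this ⊢
    linarith
  obtain ⟨μ, hμ, hμr⟩ := exists_phase_mul_eq hcorner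
  refine ⟨V μ, hV μ hμ, ?_⟩
  ext i j
  fin_cases i <;> fin_cases j
  · exact (hcol μ hμ).1.symm
  · change (r : ℂ) = _
    rw [← hμr]
    simp [V, Matrix.mul_apply, Fin.sum_univ_two, Matrix.star_apply]
    ring
  · exact (hcol μ hμ).2.symm
  · exact (hlast μ hμ).symm

/-! ### Phases and supporting half-planes -/

/-- The constraint that a supporting half-plane `Re (ζ z) ≤ m` of the numerical range puts on the
trace, the determinant and the Frobenius norm. -/
theorem det_sub_re_smul_nonneg (M : Matrix (Fin 2) (Fin 2) ℂ) (m : ℝ) {ζ : ℂ} (hζ : ‖ζ‖ = 1)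
    (h : ∀ x : EuclideanSpace ℂ (Fin 2), ‖x‖ = 1 → (ζ * inner ℂ x (matOp M x)).re ≤ m) :
    0 ≤ m ^ 2 - m * (ζ * M.trace).re + (‖M.trace‖ ^ 2 - frobeniusSq M) / 4 +
      (ζ ^ 2 * M.det).re / 2 := by
  have key := det_sub_re_nonneg (ζ • M) m fun x => by
    rw [matOp_smul, _root_.smul_apply, inner_smul_right]
    rcases eq_or_ne x 0 with rfl | hx
    · simp
    · have hx' : ‖x‖ ≠ 0 := norm_ne_zero_iff.2 hx
      have h1 := h (((‖x‖⁻¹ : ℝ) : ℂ) • x) (by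
        rw [norm_smul, Complex.norm_real, norm_inv, norm_norm, inv_mul_cancel₀ hx'])
      have e : ζ * inner ℂ (((‖x‖⁻¹ : ℝ) : ℂ) • x) (matOp M (((‖x‖⁻¹ : ℝ) : ℂ) • x)) =
          ((‖x‖⁻¹ ^ 2 : ℝ) : ℂ) * (ζ * inner ℂ x (matOp M x)) := by
        rw [map_smul, inner_smul_left, inner_smul_right, Complex.conj_ofReal]
        push_cast
        ring
      rw [e, Complex.re_ofReal_mul, inv_pow, inv_mul_le_iff₀ (by positivity)] at h1
      linarith
  have e1 : frobeniusSq (ζ • M) = frobeniusSq M := by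
    rw [frobeniusSq_eq_sum, frobeniusSq_eq_sum]
    simp [hζ]
  rw [e1, Matrix.trace_smul, Matrix.det_smul, smul_eq_mul, norm_mul, hζ, one_mul] at key
  simpa using key

/-- A phase in the right half-plane whose square rotates `d` to the positive real axis. -/
theorem exists_sq_phase (d : ℂ) :
    ∃ η : ℂ, ‖η‖ = 1 ∧ 0 ≤ η.re ∧ d = ‖d‖ * (star η) ^ 2 := by
  obtain ⟨μ, hμ, hμd⟩ := exists_phase_mul_eq (b := d) rfl
  obtain ⟨ν, hν⟩ := IsAlgClosed.exists_pow_nat_eq μ (n := 2) two_pos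
  have hν1 : ‖ν‖ = 1 := by
    have : ‖ν‖ ^ 2 = 1 := by rw [← norm_pow, hν, hμ]
    exact (pow_eq_one_iff_of_nonneg (norm_nonneg _) two_ne_zero).1 this
  have hstar : star ν * ν = 1 := by
    rw [Complex.star_def, Complex.conj_mul', hν1]; simp
  have hd : d = ‖d‖ * (star ν) ^ 2 := by
    rw [← hμd, ← hν]
    linear_combination (-d) * (star ν * ν + 1) * hstar
  rcases le_total 0 ν.re with h | h
  · exact ⟨ν, hν1, h, hd⟩
  · exact ⟨-ν, by simpa using hν1, by simpa using h, by simpa using hd⟩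

/-- Phases `a + i b` of argument at most `π / 2 - α` in modulus map the sector into the right
half-plane. -/
theorem re_mul_nonneg_of_mem_sector {α a b : ℝ} {z : ℂ} (hc : 0 ≤ Real.cos α)
    (hr : 0 < Real.sin α) (ha : 0 ≤ a) (hab : |b| * Real.sin α ≤ a * Real.cos α)
    (hz : z ∈ sector α) : 0 ≤ a * z.re - b * z.im := by
  have hz' : |z.im| * Real.cos α ≤ z.re * Real.sin α := hz
  have hre : 0 ≤ z.re :=
    nonneg_of_mul_nonneg_left ((mul_nonneg (abs_nonneg _) hc).trans hz') hr
  suffices |b| * |z.im| ≤ a * z.re by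
    rw [← abs_mul] at this
    linarith [le_abs_self (b * z.im)]
  rcases hc.eq_or_lt with h0 | h0
  · rw [← h0, mul_zero] at hab
    have : |b| = 0 := by nlinarith [abs_nonneg b]
    rw [this, zero_mul]
    positivity
  · have := mul_le_mul hab hz' (by positivity) (by positivity)
    refine le_of_mul_le_mul_right (a := Real.sin α * Real.cos α) ?_ (by positivity)
    linarith

theorem inner_matOp_single (M : Matrix (Fin 2) (Fin 2) ℂ) (i : Fin 2) :
    inner ℂ (EuclideanSpace.single i (1 : ℂ)) (matOp M (EuclideanSpace.single i 1)) = M i i := by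
  rw [inner_matOp]
  fin_cases i <;> simp

/-! ### The extremal matrix -/

/-- The numerical radius of the extremal matrix is at most `1 / √(1 + s)`. -/
theorem norm_inner_extremalMatrix_le {s : ℝ} (hs : 0 < s) (hs1 : s ≤ 1)
    (x : EuclideanSpace ℂ (Fin 2)) (hx : ‖x‖ = 1) :
    ‖inner ℂ x (matOp (extremalMatrix s) x)‖ ^ 2 * (1 + s) ≤ 1 := by
  set p := √(1 + s - s ^ 2) with hp
  set q := √(s + s ^ 2) with hq
  have hp2 : p ^ 2 = 1 + s - s ^ 2 := Real.sq_sqrt (by nlinarith)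
  have hq2 : q ^ 2 = s + s ^ 2 := Real.sq_sqrt (by positivity)
  have hx2 : ‖x 0‖ ^ 2 + ‖x 1‖ ^ 2 = 1 := by rw [← norm_sq_fin_two, hx, one_pow]
  have hk : 0 < 1 + 2 * s := by linarith
  -- `(A, X, Y)` is the point of the Bloch sphere that represents the unit vector `x`
  obtain ⟨A, X, Y, hAXY, hin⟩ : ∃ A X Y : ℝ, A ^ 2 + X ^ 2 + Y ^ 2 = 1 ∧
      inner ℂ x (matOp (extremalMatrix s) x) =
        (1 / (1 + 2 * s) : ℝ) * (⟨p + s * X, q * A + s * Y⟩ : ℂ) := by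
    have hx2' := hx2
    simp only [Complex.sq_norm, Complex.normSq_apply] at hx2'
    refine ⟨‖x 0‖ ^ 2 - ‖x 1‖ ^ 2, 2 * (star (x 0) * x 1).re, 2 * (star (x 0) * x 1).im, ?_, ?_⟩
    · simp only [Complex.sq_norm, Complex.normSq_apply]
      simp
      linear_combination (((x 0).re * (x 0).re + (x 0).im * (x 0).im) +
        ((x 1).re * (x 1).re + (x 1).im * (x 1).im) + 1) * hx2'
    · have hz : (1 + 2 * (s : ℂ)) ≠ 0 := by exact_mod_cast hk.ne'
      have hp' : (⟨p + s * (2 * (star (x 0) * x 1).re), q * (‖x 0‖ ^ 2 - ‖x 1‖ ^ 2) +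
          s * (2 * (star (x 0) * x 1).im)⟩ : ℂ) =
          star (x 0) * ((p + Complex.I * q) * x 0 + 2 * s * x 1) +
            star (x 1) * ((p - Complex.I * q) * x 1) := by
        simp only [Complex.sq_norm, Complex.normSq_apply]
        apply Complex.ext <;> simp
        · linear_combination (-p) * hx2'
        · ring
      rw [hp', inner_matOp]
      simp [extremalMatrix, ← hp, ← hq]
      ring
  have hnorm : ‖inner ℂ x (matOp (extremalMatrix s) x)‖ ^ 2 =
      ((p + s * X) ^ 2 + (q * A + s * Y) ^ 2) / (1 + 2 * s) ^ 2 := by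
    rw [hin, norm_mul, mul_pow, Complex.norm_real, Complex.sq_norm, Complex.normSq_apply]
    simp
    ring
  rw [hnorm, div_mul_eq_mul_div, div_le_one (by positivity)]
  have h1 : (q * A + s * Y) ^ 2 ≤ (s + 2 * s ^ 2) * (1 - X ^ 2) := by
    have e : (s + 2 * s ^ 2) * (1 - X ^ 2) - (q * A + s * Y) ^ 2 = (q * Y - s * A) ^ 2 := by
      rw [show 1 - X ^ 2 = A ^ 2 + Y ^ 2 by linarith]
      linear_combination (-(A ^ 2 + Y ^ 2)) * hq2
    linarith [sq_nonneg (q * Y - s * A)]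
  have h2 : (1 + 2 * s) ^ 2 - ((p + s * X) ^ 2 + (s + 2 * s ^ 2) * (1 - X ^ 2)) * (1 + s) =
      s * (p - (1 + s) * X) ^ 2 := by
    linear_combination (-(1 + 2 * s)) * hp2
  nlinarith [mul_nonneg hs.le (sq_nonneg (p - (1 + s) * X))]

/-- The extremal matrix is recognized by its trace, determinant and Frobenius norm. -/
theorem unitarilySimilar_extremalMatrix {s : ℝ} (hs : 0 < s) (hs1 : s ≤ 1)
    (M : Matrix (Fin 2) (Fin 2) ℂ) (htre : 0 ≤ M.trace.re) (htim : M.trace.im = 0)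
    (htsq : M.trace.re ^ 2 = (1 + 1 / (1 + 2 * s)) ^ 2 - 4 * (1 / (1 + 2 * s)) * s)
    (hd : M.det = ((1 / (1 + 2 * s) : ℝ) : ℂ))
    (hF : frobeniusSq M = 1 + (1 / (1 + 2 * s)) ^ 2) :
    UnitarilySimilar M (extremalMatrix s) := by
  have hk : 0 < 1 + 2 * s := by linarith
  have hkC : (1 + 2 * (s : ℂ)) ≠ 0 := by exact_mod_cast hk.ne'
  set p := √(1 + s - s ^ 2) with hpdef
  set q := √(s + s ^ 2) with hqdef
  have hp2 : p ^ 2 = 1 + s - s ^ 2 := Real.sq_sqrt (by nlinarith)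
  have hq2 : q ^ 2 = s + s ^ 2 := Real.sq_sqrt (by positivity)
  have htr : M.trace.re = 2 * p / (1 + 2 * s) := by
    refine (pow_left_inj₀ htre (by positivity) two_ne_zero).1 ?_
    rw [htsq, div_pow, mul_pow, hp2]
    field_simp
    ring
  have htC : M.trace = 2 * p / (1 + 2 * s) := by
    have : M.trace = (M.trace.re : ℂ) := Complex.ext rfl (by simpa using htim)
    rw [this, htr]
    push_cast
    rfl
  have hE : extremalMatrix s = !![(p + Complex.I * q) / (1 + 2 * s), ((2 * s / (1 + 2 * s) : ℝ) : ℂ);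
      0, (p - Complex.I * q) / (1 + 2 * s)] := by
    ext i j
    fin_cases i <;> fin_cases j <;> simp [extremalMatrix, ← hpdef, ← hqdef] <;> ring
  have hp2C : (p : ℂ) ^ 2 = 1 + s - s ^ 2 := by exact_mod_cast hp2
  have hq2C : (q : ℂ) ^ 2 = s + s ^ 2 := by exact_mod_cast hq2
  rw [hE]
  have hnk : ‖(1 + 2 * (s : ℂ))‖ = 1 + 2 * s := by
    rw [show (1 + 2 * (s : ℂ)) = ((1 + 2 * s : ℝ) : ℂ) by push_cast; rfl, Complex.norm_real,
      Real.norm_of_nonneg hk.le]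
  have hn1 : ‖(p : ℂ) + Complex.I * q‖ ^ 2 = 1 + 2 * s := by
    rw [Complex.sq_norm, Complex.normSq_apply]
    simp
    linarith
  have hn2 : ‖(p : ℂ) - Complex.I * q‖ ^ 2 = 1 + 2 * s := by
    rw [Complex.sq_norm, Complex.normSq_apply]
    simp
    linarith
  refine unitarilySimilar_upper_triangular M _ _ _ (by positivity) ?_ ?_ ?_
  · rw [htC]; ring
  · rw [hd]
    push_cast
    field_simp
    linear_combination (-1) * hp2C - hq2C + (q : ℂ) ^ 2 * Complex.I_sq
  · rw [norm_div, norm_div, div_pow, div_pow, hn1, hn2, hnk, hF]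
    field_simp
    ring

/-! ### Norm against numerical radius -/

/-- The theorem for a matrix of norm one, with any upper bound `w` for the moduli of the numerical
range in the place of the numerical radius. -/
theorem one_le_radius_sq_mul {α w : ℝ} (hα₀ : 0 < α) (hα₁ : α ≤ Real.pi / 2)
    (M : Matrix (Fin 2) (Fin 2) ℂ) (hM : ‖matOp M‖ = 1)
    (hsec : ∀ x : EuclideanSpace ℂ (Fin 2), ‖x‖ = 1 → inner ℂ x (matOp M x) ∈ sector α)
    (hw : ∀ x : EuclideanSpace ℂ (Fin 2), ‖x‖ = 1 → ‖inner ℂ x (matOp M x)‖ ≤ w) :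
    1 ≤ w ^ 2 * (1 + Real.sin α ^ 2) ∧ (w ^ 2 * (1 + Real.sin α ^ 2) = 1 →
      UnitarilySimilar M (extremalMatrix (Real.sin α ^ 2))) := by
  have hr : 0 < Real.sin α := Real.sin_pos_of_pos_of_lt_pi hα₀ (by linarith [Real.pi_pos])
  have hc : 0 ≤ Real.cos α := Real.cos_nonneg_of_mem_Icc ⟨by linarith, hα₁⟩
  have hcr : Real.cos α ^ 2 + Real.sin α ^ 2 = 1 := Real.cos_sq_add_sin_sq α
  obtain ⟨hF, hσ1⟩ := frobeniusSq_of_norm_eq_one M hM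
  obtain ⟨η, hη, hη0, hd⟩ := exists_sq_phase M.det
  set σ := ‖M.det‖ with hσdef
  set t := M.trace with ht
  have hσ : 0 ≤ σ := norm_nonneg _
  have hpq : η.re ^ 2 + η.im ^ 2 = 1 := by
    have := Complex.sq_norm η
    rw [hη, Complex.normSq_apply] at this
    linarith
  have hnorm : ∀ a b : ℝ, a ^ 2 + b ^ 2 = 1 → ‖(⟨a, b⟩ : ℂ)‖ = 1 := by
    intro a b hab
    rw [← pow_eq_one_iff_of_nonneg (norm_nonneg _) two_ne_zero, Complex.sq_norm,
      Complex.normSq_apply]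
    linarith
  obtain ⟨hK, hKeq⟩ := sector_det_bound (K := (‖t‖ ^ 2 - frobeniusSq M) / 4) hc hr hcr hη0 hpq hσ
    fun a b ha hab hb => by
      -- `Re (-ζ T) ≤ 0` on the unit sphere, so that `det Re (ζ T) ≥ 0`
      have := det_sub_re_smul_nonneg M 0 (ζ := -(⟨a, b⟩ : ℂ)) (by rw [norm_neg, hnorm a b hab])
        fun x hx => by
          have := re_mul_nonneg_of_mem_sector hc hr ha hb (hsec x hx)
          simp
          linarith
      have e : ((-(⟨a, b⟩ : ℂ)) ^ 2 * M.det).re =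
          σ * ((a ^ 2 - b ^ 2) * (η.re ^ 2 - η.im ^ 2) + 4 * a * b * η.re * η.im) := by
        rw [hd]
        simp [pow_two]
        ring
      rw [e] at this
      linarith
  have hdiag : ∀ i : Fin 2, M i i ∈ sector α ∧ ‖M i i‖ ≤ w := fun i => by
    rw [← inner_matOp_single M i]
    exact ⟨hsec _ (by simp), hw _ (by simp)⟩
  have htw : ‖t‖ ≤ 2 * w := by
    rw [ht, Matrix.trace_fin_two]
    linarith [norm_add_le (M 0 0) (M 1 1), (hdiag 0).2, (hdiag 1).2]
  have huxy : ‖t‖ ^ 2 = (η * t).re ^ 2 + (η * t).im ^ 2 := by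
    rw [← one_mul ‖t‖, ← hη, ← norm_mul, Complex.sq_norm, Complex.normSq_apply]
    ring
  have hs : 0 < Real.sin α ^ 2 := by positivity
  set s := Real.sin α ^ 2 with hsdef
  have hs1 : s ≤ 1 := by nlinarith
  have hA : (1 + σ) ^ 2 - 4 * σ * s ≤ ‖t‖ ^ 2 := by
    rw [hF] at hK
    linarith
  obtain ⟨h1, h2⟩ := radius_bound hs hσ hσ1 (norm_nonneg t) huxy htw hA fun κ ν hκν => by
    have := det_sub_re_smul_nonneg M w (ζ := η * (⟨κ, ν⟩ : ℂ))
      (by rw [norm_mul, hη, hnorm κ ν hκν, one_mul]) fun x hx => by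
        refine (Complex.re_le_norm _).trans ?_
        rw [norm_mul, norm_mul, hη, hnorm κ ν hκν, one_mul, one_mul]
        exact hw x hx
    have e1 : ((η * (⟨κ, ν⟩ : ℂ)) ^ 2 * M.det).re = σ * (κ ^ 2 - ν ^ 2) := by
      have hstar : star η * η = 1 := by
        rw [Complex.star_def, Complex.conj_mul', hη]; simp
      have : (η * (⟨κ, ν⟩ : ℂ)) ^ 2 * M.det = σ * (⟨κ, ν⟩ : ℂ) ^ 2 := by
        rw [hd]
        linear_combination (σ : ℂ) * (⟨κ, ν⟩ : ℂ) ^ 2 * (star η * η + 1) * hstar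
      rw [this, Complex.re_ofReal_mul]
      simp [pow_two]
    have e2 : (η * (⟨κ, ν⟩ : ℂ) * M.trace).re = κ * (η * t).re - ν * (η * t).im := by
      simp [ht]
      ring
    rw [e1, e2, hF] at this
    linarith
  refine ⟨h1, fun h3 => ?_⟩
  obtain ⟨h4, h5, h6⟩ := h2 h3
  have hσ0 : 0 < σ := by
    rcases hσ.eq_or_lt with h0 | h0
    · rw [← h0] at h4; norm_num at h4
    · exact h0
  have hq : η.im = 0 := hKeq (by rw [hF, h5]; ring) hσ0
  have hp : η.re = 1 := by
    rw [hq] at hpq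
    nlinarith
  have hη1 : η = 1 := Complex.ext hp hq
  rw [hη1] at hd h6
  rw [one_mul] at h6
  have htre : 0 ≤ t.re := by
    have : ∀ i : Fin 2, 0 ≤ (M i i).re := fun i =>
      nonneg_of_mul_nonneg_left ((mul_nonneg (abs_nonneg _) hc).trans (hdiag i).1) hr
    rw [ht, Matrix.trace_fin_two, Complex.add_re]
    linarith [this 0, this 1]
  have hk : 0 < 1 + 2 * s := by linarith
  have hσs : σ = 1 / (1 + 2 * s) := by rw [eq_div_iff hk.ne']; exact h4
  refine unitarilySimilar_extremalMatrix hs hs1 M htre h6 ?_ ?_ ?_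
  · rw [Complex.sq_norm, Complex.normSq_apply, h6] at h5
    rw [← ht, ← hσs]
    linarith
  · rw [hd, hσs]
    simp
  · rw [hF, hσs]

theorem theorem2p1 (α : ℝ) (hα₀ : 0 < α) (hα₁ : α ≤ Real.pi / 2)
    (T : Matrix (Fin 2) (Fin 2) ℂ) (hT : T ≠ 0) (hW : numericalRange (matOp T) ⊆ sector α) :
    ‖matOp T‖ ≤ numericalRadius (matOp T) * Real.sqrt (1 + Real.sin α ^ 2) ∧
    (‖matOp T‖ = numericalRadius (matOp T) * Real.sqrt (1 + Real.sin α ^ 2) ↔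
      UnitarilySimilar ((‖matOp T‖ : ℂ)⁻¹ • T) (extremalMatrix (Real.sin α ^ 2))) := by
  have hr : 0 < Real.sin α := Real.sin_pos_of_pos_of_lt_pi hα₀ (by linarith [Real.pi_pos])
  have hn : 0 < ‖matOp T‖ := by
    refine norm_pos_iff.2 fun h => hT ?_
    exact (Matrix.toEuclideanCLM (n := Fin 2) (𝕜 := ℂ)).injective (h.trans (map_zero _).symm)
  set n := ‖matOp T‖ with hndef
  set w := numericalRadius (matOp T) with hwdef
  set k := Real.sqrt (1 + Real.sin α ^ 2) with hkdef
  have hk2 : k ^ 2 = 1 + Real.sin α ^ 2 := Real.sq_sqrt (by positivity)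
  have hk : 0 < k := Real.sqrt_pos.2 (by positivity)
  have hle : ∀ x : EuclideanSpace ℂ (Fin 2), ‖x‖ = 1 → ‖inner ℂ x (matOp T x)‖ ≤ w :=
    fun x hx => le_csSup (bddAbove_norm_numericalRange _) ⟨_, ⟨x, hx, rfl⟩, rfl⟩
  have hw0 : 0 ≤ w := Real.sSup_nonneg (by rintro _ ⟨μ, -, rfl⟩; exact norm_nonneg μ)
  have hinner : ∀ x, inner ℂ x (matOp ((n : ℂ)⁻¹ • T) x) = ((n⁻¹ : ℝ) : ℂ) * inner ℂ x (matOp T x) :=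
    fun x => by
      rw [matOp_smul, _root_.smul_apply, inner_smul_right, Complex.ofReal_inv]
  obtain ⟨h1, h2⟩ := one_le_radius_sq_mul (w := w / n) hα₀ hα₁ ((n : ℂ)⁻¹ • T)
    (by rw [matOp_smul, norm_smul, norm_inv, Complex.norm_real, norm_norm, inv_mul_cancel₀ hn.ne'])
    (fun x hx => by
      have h : |(inner ℂ x (matOp T x)).im| * Real.cos α ≤
        (inner ℂ x (matOp T x)).re * Real.sin α := hW ⟨x, hx, rfl⟩
      rw [hinner]
      change |(((n⁻¹ : ℝ) : ℂ) * inner ℂ x (matOp T x)).im| * Real.cos α ≤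
        (((n⁻¹ : ℝ) : ℂ) * inner ℂ x (matOp T x)).re * Real.sin α
      rw [Complex.im_ofReal_mul, Complex.re_ofReal_mul, abs_mul, abs_of_pos (inv_pos.2 hn),
        mul_assoc, mul_assoc]
      gcongr)
    (fun x hx => by
      rw [hinner, norm_mul, Complex.norm_real, norm_inv, norm_norm, div_eq_inv_mul]
      have := hle x hx
      gcongr)
  have hwk : (w / n) ^ 2 * (1 + Real.sin α ^ 2) = (w * k / n) ^ 2 := by
    rw [← hk2]; ring
  rw [hwk] at h1 h2
  have hwk0 : 0 ≤ w * k / n := by positivity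
  have hge : n ≤ w * k := by
    rw [← one_le_div hn]
    exact (one_le_sq_iff₀ hwk0).1 h1
  refine ⟨hge, fun h => h2 ?_, fun h => le_antisymm hge ?_⟩
  · rw [← h, div_self hn.ne', one_pow]
  · rw [← le_div_iff₀ hk]
    refine Real.sSup_le ?_ (by positivity)
    rintro _ ⟨_, ⟨x, hx, rfl⟩, rfl⟩
    obtain ⟨y, hy, hyx⟩ := h.exists_inner_eq x hx
    have h3 := norm_inner_extremalMatrix_le (s := Real.sin α ^ 2) (by positivity)
      (Real.sin_sq_le_one α) y hy
    rw [hyx, hinner, ← hk2, norm_mul, Complex.norm_real, norm_inv, Real.norm_of_nonneg hn.le,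
      ← mul_pow, sq_le_one_iff₀ (by positivity), mul_assoc, inv_mul_le_iff₀ hn, mul_one] at h3
    exact (le_div_iff₀ hk).2 h3
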